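/- Let $R$ be a commutative ring, $x = x_1,\ldots,x_k$ a finite sequence of elements of $R$, $J=(x_1,\ldots,x_k)R$, and $M$ an $R$-module. Notation. $\Gamma_J(M)=\{m\in M : J^n m=0 \text{ for some } n\}$ is the $J$-torsion functor and $H^i_J$ are its right derived functors. $\mathcal D_J(M)=\varinjlim_n \operatorname{Hom}_R(J^n,M)$ is the ideal transform, and $\tau_M: M\to\mathcal D_J(M)$ sends $m$ to the class of $r\mapsto rm$. Let $$M\xrightarrow{d^0}\bigoplus_{i} M_{x_i}\xrightarrow{d^1}\bigoplus_{i<j}M_{x_ix_j}\to\cdots$$ be the Čech complex of $M$ with respect to $x$. Put $\check H^0_x(M)=\ker d^0\subseteq M$, $\check D^0_x(M)=\ker d^1$ and $\check H^1_x(M)=\ker d^1/\operatorname{im} d^0$. The map $$\rho_M:\mathcal D_J(M)\to\check D^0_x(M)$$ sends the class of $\phi\in\operatorname{Hom}_R(J^n,M)$ to $(\phi(x_i^n)/x_i^n)_{i=1}^k$. The sequence $x$ is called weakly pro-regular if for all $i>0$ and $n\ge 1$ there is $m\ge n$ such that the natural map $H_i(x_1^m,\ldots,x_k^m;R)\to H_i(x_1^n,\ldots,x_k^n;R)$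 of Koszul homology modules is zero. Lemma. There are homomorphisms $\delta_M:\mathcal D_J(M)\to H^1_J(M)$ and $\eta_M:H^1_J(M)\to\check H^1_x(M)$, both natural in $M$, such that for every $M$ the following holds. 1. One has $\Gamma_J(M)=\check H^0_x(M)$ as submodules of $M$, and the diagram $$\begin{array}{ccccccccccc} 0&\to&\Gamma_J(M)&\to&M&\xrightarrow{\tau_M}&\mathcal D_J(M)&\xrightarrow{\delta_M}&H^1_J(M)&\to&0\\ &&\|&&\|&&\downarrow{\scriptstyle\rho_M}&&\downarrow{\scriptstyle\eta_M}&&\\ 0&\to&\check H^0_x(M)&\to&M&\xrightarrow{d^0}&\check D^0_x(M)&\to&\check H^1_x(M)&\to&0 \end{array}$$ is commutative with exact rows, where the unnamed maps are the inclusions and the projection. 2. The maps $\rho_M$ and $\eta_M$ are injective. 3. The projection $\check D^0_x(M)\to\check H^1_x(M)$ induces an isomorphism $\check D^0_x(M)/\rho_M(\mathcal D_J(M))\cong\check H^1_x(M)/\eta_M(H^1_J(M))$. 4. If $x$ is weakly pro-regular, then $\rho_M$ is an isomorphism. -/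

import Mathlib

open CategoryTheory

universe u

namespace CechLocal

noncomputable section

/-! Conventions: `R` is a commutative ring, `M` an `R`-module, `x : Fin k → R` a finite sequence,
and `seqIdeal x` the ideal generated by `x`. -/

/-- The ideal generated by the entries of the sequence `x`. -/
abbrev seqIdeal {R : Type u} [CommRing R] {k : ℕ} (x : Fin k → R) : Ideal R :=
  Ideal.span (Set.range x)

/-! ### Torsion functor and local cohomology -/

/-- The `J`-torsion submodule of `M`: all elements annihilated by some power of `J`. -/
def torsion {R : Type u} [CommRing R] (J : Ideal R) (M : Type u) [AddCommGroup M] [Module R M] :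
    Submodule R M where
  carrier := {m | ∃ n : ℕ, ∀ r ∈ J ^ n, r • m = 0}
  zero_mem' := ⟨0, fun r _ => smul_zero r⟩
  add_mem' := by
    rintro a b ⟨n, hn⟩ ⟨m, hm⟩
    refine ⟨n + m, fun r hr => ?_⟩
    rw [smul_add, hn r (Ideal.pow_le_pow_right (Nat.le_add_right n m) hr),
      hm r (Ideal.pow_le_pow_right (Nat.le_add_left m n) hr), add_zero]
  smul_mem' := by
    rintro c a ⟨n, hn⟩
    exact ⟨n, fun r hr => by rw [smul_comm, hn r hr, smul_zero]⟩

theorem torsion_map {R : Type u} [CommRing R] (J : Ideal R) {M N : Type u}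
    [AddCommGroup M] [Module R M] [AddCommGroup N] [Module R N] (f : M →ₗ[R] N) :
    ∀ m ∈ torsion J M, f m ∈ torsion J N := by
  rintro m ⟨n, hn⟩
  exact ⟨n, fun r hr => by rw [← map_smul, hn r hr, map_zero]⟩

/-- The `J`-torsion functor. -/
def torsionFunctor {R : Type u} [CommRing R] (J : Ideal R) : ModuleCat.{u} R ⥤ ModuleCat.{u} R where
  obj M := ModuleCat.of R (torsion J M)
  map f := ModuleCat.ofHom (f.hom.restrict (torsion_map J f.hom))

instance {R : Type u} [CommRing R] (J : Ideal R) : (torsionFunctor J).Additive where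

/-- The local cohomology functors: the right derived functors of the `J`-torsion functor. -/
def localCoh {R : Type u} [CommRing R] (J : Ideal R) (i : ℕ) :
    ModuleCat.{u} R ⥤ ModuleCat.{u} R :=
  (torsionFunctor J).rightDerived i

/-! ### The ideal transform -/

/-- Restriction `Hom (J ^ m, M) → Hom (J ^ n, M)` for `m ≤ n`. -/
def homRestrict {R : Type u} [CommRing R] (J : Ideal R) (M : Type u) [AddCommGroup M] [Module R M]
    (m n : ℕ) (h : m ≤ n) :
    (↥(J ^ m) →ₗ[R] M) →ₗ[R] (↥(J ^ n) →ₗ[R] M) :=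
  LinearMap.lcomp R M (Submodule.inclusion (Ideal.pow_le_pow_right h))

/-- The ideal transform: the direct limit of the modules `Hom (J ^ n, M)`. -/
abbrev IdealTransform {R : Type u} [CommRing R] (J : Ideal R) (M : Type u)
    [AddCommGroup M] [Module R M] : Type u :=
  Module.DirectLimit (fun n : ℕ => (↥(J ^ n) →ₗ[R] M)) (homRestrict J M)

/-- The class in the ideal transform of a homomorphism `J ^ n → M`. -/
def IdealTransform.of {R : Type u} [CommRing R] (J : Ideal R) (M : Type u)
    [AddCommGroup M] [Module R M] (n : ℕ) : (↥(J ^ n) →ₗ[R] M) →ₗ[R] IdealTransform J M :=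
  Module.DirectLimit.of R ℕ (fun n : ℕ => (↥(J ^ n) →ₗ[R] M)) (homRestrict J M) n

/-- Functoriality of the ideal transform: postcomposition. -/
def IdealTransform.map {R : Type u} [CommRing R] (J : Ideal R) {M N : Type u}
    [AddCommGroup M] [Module R M] [AddCommGroup N] [Module R N] (f : M →ₗ[R] N) :
    IdealTransform J M →ₗ[R] IdealTransform J N :=
  Module.DirectLimit.map (f := homRestrict J M) (f' := homRestrict J N)
    (fun n => (LinearMap.compRight R f : (↥(J ^ n) →ₗ[R] M) →ₗ[R] (↥(J ^ n) →ₗ[R] N)))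
    (fun _ _ _ => by ext; rfl)

theorem IdealTransform.map_of {R : Type u} [CommRing R] (J : Ideal R) {M N : Type u}
    [AddCommGroup M] [Module R M] [AddCommGroup N] [Module R N] (f : M →ₗ[R] N) (n : ℕ)
    (φ : ↥(J ^ n) →ₗ[R] M) :
    IdealTransform.map J f (IdealTransform.of J M n φ) = IdealTransform.of J N n (f ∘ₗ φ) := by
  exact Module.DirectLimit.map_apply_of (f := homRestrict J M) (f' := homRestrict J N)
    (fun n => (LinearMap.compRight R f : (↥(J ^ n) →ₗ[R] M) →ₗ[R] (↥(J ^ n) →ₗ[R] N))) _ φ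

/-- The ideal transform as a functor. -/
def idealTransformFunctor {R : Type u} [CommRing R] (J : Ideal R) :
    ModuleCat.{u} R ⥤ ModuleCat.{u} R where
  obj M := ModuleCat.of R (IdealTransform J M)
  map f := ModuleCat.ofHom (IdealTransform.map J f.hom)
  map_id M := by
    refine ModuleCat.hom_ext (LinearMap.ext fun z => ?_)
    obtain ⟨n, φ, rfl⟩ := Module.DirectLimit.exists_of z
    exact IdealTransform.map_of J _ n φ
  map_comp f g := by
    refine ModuleCat.hom_ext (LinearMap.ext fun z => ?_)
    obtain ⟨n, φ, rfl⟩ := Module.DirectLimit.exists_of z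
    refine (IdealTransform.map_of J _ n φ).trans ?_
    refine Eq.trans ?_ (congrArg (IdealTransform.map J g.hom)
      (IdealTransform.map_of J f.hom n φ)).symm
    exact (IdealTransform.map_of J g.hom n (f.hom ∘ₗ φ)).symm

/-- The natural map `M → IdealTransform J M`, sending `m` to the class of `r ↦ r • m`. -/
def tau {R : Type u} [CommRing R] (J : Ideal R) (M : Type u) [AddCommGroup M] [Module R M] :
    M →ₗ[R] IdealTransform J M :=
  IdealTransform.of J M 0 ∘ₗ
    { toFun := fun m => (LinearMap.toSpanSingleton R M m) ∘ₗ (J ^ 0).subtype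
      map_add' := fun a b => by ext r; simp
      map_smul' := fun c a => by ext r; exact smul_comm (r : R) c a }

/-! ### Čech cohomology in low degrees -/

/-- The localization `M_a` of `M` at the powers of `a`. -/
abbrev Loc {R : Type u} [CommRing R] (a : R) (M : Type u) [AddCommGroup M] [Module R M] : Type u :=
  LocalizedModule (Submonoid.powers a) M

/-- The localization map `M → M_a`. -/
abbrev toLoc {R : Type u} [CommRing R] (a : R) (M : Type u) [AddCommGroup M] [Module R M] :
    M →ₗ[R] Loc a M :=
  LocalizedModule.mkLinearMap (Submonoid.powers a) M

theorem isUnit_of_dvd {R : Type u} [CommRing R] {a b : R} (h : a ∣ b) (M : Type u)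
    [AddCommGroup M] [Module R M] (s : Submonoid.powers a) :
    IsUnit (algebraMap R (Module.End R (Loc b M)) s) := by
  obtain ⟨_, n, rfl⟩ := s
  obtain ⟨c, rfl⟩ := h
  have hu := IsLocalizedModule.map_units (S := Submonoid.powers (a * c)) (toLoc (a * c) M)
    ⟨(a * c) ^ n, n, rfl⟩
  simp only [mul_pow, map_mul] at hu
  exact ((Commute.all (a ^ n) (c ^ n)).map (algebraMap R _)).isUnit_mul_iff.1 hu |>.1

/-- The canonical map `M_a → M_b` for `a ∣ b`. -/
def locMap {R : Type u} [CommRing R] {a b : R} (h : a ∣ b) (M : Type u)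
    [AddCommGroup M] [Module R M] : Loc a M →ₗ[R] Loc b M :=
  LocalizedModule.lift (Submonoid.powers a) (toLoc b M) (isUnit_of_dvd h M)

theorem locMap_toLoc {R : Type u} [CommRing R] {a b : R} (h : a ∣ b) (M : Type u)
    [AddCommGroup M] [Module R M] (m : M) : locMap h M (toLoc a M m) = toLoc b M m :=
  LinearMap.congr_fun (LocalizedModule.lift_comp (Submonoid.powers a) (toLoc b M)
    (isUnit_of_dvd h M)) m

/-- The fraction `m / a ^ n` in `M_a`. -/
abbrev frac {R : Type u} [CommRing R] (a : R) {M : Type u} [AddCommGroup M] [Module R M]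
    (m : M) (n : ℕ) : Loc a M :=
  LocalizedModule.mk m ⟨a ^ n, n, rfl⟩

theorem smul_frac {R : Type u} [CommRing R] (a : R) {M : Type u} [AddCommGroup M] [Module R M]
    (m : M) (n : ℕ) : a ^ n • frac a m n = toLoc a M m := by
  rw [LocalizedModule.smul'_mk, LocalizedModule.mkLinearMap_apply]
  exact LocalizedModule.mk_cancel (S := Submonoid.powers a) ⟨a ^ n, n, rfl⟩ m

theorem smul_pow_injective {R : Type u} [CommRing R] {a b : R} (h : a ∣ b) {M : Type u}
    [AddCommGroup M] [Module R M] (n : ℕ) {y z : Loc b M} (e : a ^ n • y = a ^ n • z) : y = z :=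
  ((Module.End.isUnit_iff _).1 (isUnit_of_dvd h M ⟨a ^ n, n, rfl⟩)).1 e

/-- Degree one of the Čech complex. -/
abbrev Cech1 {R : Type u} [CommRing R] {k : ℕ} (x : Fin k → R) (M : Type u)
    [AddCommGroup M] [Module R M] : Type u :=
  (i : Fin k) → Loc (x i) M

/-- Degree two of the Čech complex. -/
abbrev Cech2 {R : Type u} [CommRing R] {k : ℕ} (x : Fin k → R) (M : Type u)
    [AddCommGroup M] [Module R M] : Type u :=
  (p : {p : Fin k × Fin k // p.1 < p.2}) → Loc (x p.1.1 * x p.1.2) M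

/-- The differential `M → ⨁ M_{x_i}`. -/
def cechd0 {R : Type u} [CommRing R] {k : ℕ} (x : Fin k → R) (M : Type u)
    [AddCommGroup M] [Module R M] : M →ₗ[R] Cech1 x M :=
  LinearMap.pi fun i => toLoc (x i) M

/-- The differential `⨁ M_{x_i} → ⨁_{i < j} M_{x_i x_j}`, sending `f` to `f_j - f_i` in the
component `(i, j)`. -/
def cechd1 {R : Type u} [CommRing R] {k : ℕ} (x : Fin k → R) (M : Type u)
    [AddCommGroup M] [Module R M] : Cech1 x M →ₗ[R] Cech2 x M :=
  LinearMap.pi fun p =>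
    locMap (Dvd.intro_left (x p.1.1) rfl) M ∘ₗ LinearMap.proj p.1.2 -
      locMap (Dvd.intro (x p.1.2) rfl) M ∘ₗ LinearMap.proj p.1.1

theorem cechd1_cechd0 {R : Type u} [CommRing R] {k : ℕ} (x : Fin k → R) (M : Type u)
    [AddCommGroup M] [Module R M] (m : M) : cechd1 x M (cechd0 x M m) = 0 := by
  funext p
  simp [cechd1, cechd0, -LocalizedModule.mkLinearMap_apply, locMap_toLoc]

/-- The Čech cohomology in degree zero, as a submodule of `M`. -/
def CechH0 {R : Type u} [CommRing R] {k : ℕ} (x : Fin k → R) (M : Type u)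
    [AddCommGroup M] [Module R M] : Submodule R M :=
  LinearMap.ker (cechd0 x M)

/-- The zeroth cohomology of the global Čech complex `⨁ M_{x_i} → ⨁ M_{x_i x_j} → ⋯`. -/
def CechD0 {R : Type u} [CommRing R] {k : ℕ} (x : Fin k → R) (M : Type u)
    [AddCommGroup M] [Module R M] : Submodule R (Cech1 x M) :=
  LinearMap.ker (cechd1 x M)

/-- The natural map from `M` to the zeroth cohomology of the global Čech complex. -/
def cechAug {R : Type u} [CommRing R] {k : ℕ} (x : Fin k → R) (M : Type u)
    [AddCommGroup M] [Module R M] : M →ₗ[R] CechD0 x M :=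
  (cechd0 x M).codRestrict _ (cechd1_cechd0 x M)

/-- The Čech cohomology in degree one: cocycles modulo coboundaries. -/
abbrev CechH1 {R : Type u} [CommRing R] {k : ℕ} (x : Fin k → R) (M : Type u)
    [AddCommGroup M] [Module R M] : Type u :=
  CechD0 x M ⧸ LinearMap.range (cechAug x M)

/-- The projection from cocycles to Čech cohomology in degree one. -/
def cechProj {R : Type u} [CommRing R] {k : ℕ} (x : Fin k → R) (M : Type u)
    [AddCommGroup M] [Module R M] : CechD0 x M →ₗ[R] CechH1 x M :=
  (LinearMap.range (cechAug x M)).mkQ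

/-- Functoriality of `M_a` in `M`. -/
def locFun {R : Type u} [CommRing R] (a : R) {M N : Type u}
    [AddCommGroup M] [Module R M] [AddCommGroup N] [Module R N] (f : M →ₗ[R] N) :
    Loc a M →ₗ[R] Loc a N :=
  IsLocalizedModule.map (Submonoid.powers a) (toLoc a M) (toLoc a N) f

theorem locFun_toLoc {R : Type u} [CommRing R] (a : R) {M N : Type u}
    [AddCommGroup M] [Module R M] [AddCommGroup N] [Module R N] (f : M →ₗ[R] N) (m : M) :
    locFun a f (toLoc a M m) = toLoc a N (f m) :=
  IsLocalizedModule.map_apply (Submonoid.powers a) (toLoc a M) (toLoc a N) f m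

theorem locFun_id {R : Type u} [CommRing R] (a : R) {M : Type u} [AddCommGroup M] [Module R M]
    (y : Loc a M) : locFun a (LinearMap.id (R := R) (M := M)) y = y :=
  LinearMap.congr_fun (IsLocalizedModule.map_id (Submonoid.powers a) (toLoc a M)) y

theorem locFun_comp {R : Type u} [CommRing R] (a : R) {M N P : Type u}
    [AddCommGroup M] [Module R M] [AddCommGroup N] [Module R N] [AddCommGroup P] [Module R P]
    (f : M →ₗ[R] N) (g : N →ₗ[R] P) (y : Loc a M) :
    locFun a (g ∘ₗ f) y = locFun a g (locFun a f y) :=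
  LinearMap.congr_fun (IsLocalizedModule.map_comp' (Submonoid.powers a) (toLoc a M) (toLoc a N)
    (toLoc a P) f g) y

theorem locFun_locMap {R : Type u} [CommRing R] {a b : R} (h : a ∣ b) {M N : Type u}
    [AddCommGroup M] [Module R M] [AddCommGroup N] [Module R N] (f : M →ₗ[R] N) (y : Loc a M) :
    locFun b f (locMap h M y) = locMap h N (locFun a f y) := by
  obtain ⟨m, ⟨_, n, rfl⟩, rfl⟩ : ∃ m s, LocalizedModule.mk m s = y :=
    y.induction_on (fun m s => ⟨m, s, rfl⟩)
  refine smul_pow_injective h n ?_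
  have e := smul_frac a m n
  rw [← map_smul, ← map_smul, ← map_smul, ← map_smul]
  erw [e]
  rw [locMap_toLoc, locFun_toLoc, locFun_toLoc, locMap_toLoc]

/-- Functoriality of the zeroth cohomology of the global Čech complex. -/
def cechD0Map {R : Type u} [CommRing R] {k : ℕ} (x : Fin k → R) {M N : Type u}
    [AddCommGroup M] [Module R M] [AddCommGroup N] [Module R N] (f : M →ₗ[R] N) :
    CechD0 x M →ₗ[R] CechD0 x N :=
  (LinearMap.pi fun i => locFun (x i) f ∘ₗ LinearMap.proj i :
      Cech1 x M →ₗ[R] Cech1 x N).restrict (by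
    intro y hy
    have hy' : cechd1 x M y = 0 := hy
    change cechd1 x N _ = 0
    funext p
    have hp := congrArg (locFun (x p.1.1 * x p.1.2) f) (congrFun hy' p)
    simpa [cechd1, locFun_locMap] using hp)

theorem cechD0Map_cechAug {R : Type u} [CommRing R] {k : ℕ} (x : Fin k → R) {M N : Type u}
    [AddCommGroup M] [Module R M] [AddCommGroup N] [Module R N] (f : M →ₗ[R] N) (m : M) :
    cechD0Map x f (cechAug x M m) = cechAug x N (f m) :=
  Subtype.ext (funext fun i => locFun_toLoc (x i) f m)

/-- Functoriality of Čech cohomology in degree one. -/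
def cechH1Map {R : Type u} [CommRing R] {k : ℕ} (x : Fin k → R) {M N : Type u}
    [AddCommGroup M] [Module R M] [AddCommGroup N] [Module R N] (f : M →ₗ[R] N) :
    CechH1 x M →ₗ[R] CechH1 x N :=
  Submodule.mapQ _ _ (cechD0Map x f) (by
    rintro _ ⟨m, rfl⟩
    exact ⟨f m, (cechD0Map_cechAug x f m).symm⟩)

/-- Čech cohomology in degree one as a functor. -/
def cechH1Functor {R : Type u} [CommRing R] {k : ℕ} (x : Fin k → R) :
    ModuleCat.{u} R ⥤ ModuleCat.{u} R where
  obj M := ModuleCat.of R (CechH1 x M)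
  map f := ModuleCat.ofHom (cechH1Map x f.hom)
  map_id M := by
    refine ModuleCat.hom_ext (LinearMap.ext fun z => ?_)
    obtain ⟨y, rfl⟩ := Submodule.mkQ_surjective _ z
    refine congrArg (cechProj x M) (Subtype.ext (funext fun i => ?_))
    exact locFun_id (x i) (y.1 i)
  map_comp {M N P} f g := by
    refine ModuleCat.hom_ext (LinearMap.ext fun z => ?_)
    obtain ⟨y, rfl⟩ := Submodule.mkQ_surjective _ z
    refine congrArg (cechProj x P) (Subtype.ext (funext fun i => ?_))
    exact locFun_comp (x i) f.hom g.hom (y.1 i)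

/-! ### The comparison map -/

theorem seq_pow_mem {R : Type u} [CommRing R] {k : ℕ} (x : Fin k → R) (n : ℕ) (i : Fin k) :
    x i ^ n ∈ seqIdeal x ^ n :=
  Ideal.pow_mem_pow (Ideal.subset_span (Set.mem_range_self i)) n

/-- For `φ : J ^ n → M`, the family of fractions `φ (x_i ^ n) / x_i ^ n`. -/
def rhoLevel {R : Type u} [CommRing R] {k : ℕ} (x : Fin k → R) (M : Type u)
    [AddCommGroup M] [Module R M] (n : ℕ) :
    (↥(seqIdeal x ^ n) →ₗ[R] M) →ₗ[R] Cech1 x M where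
  toFun φ i := frac (x i) (φ ⟨x i ^ n, seq_pow_mem x n i⟩) n
  map_add' φ ψ := by
    funext i
    refine smul_pow_injective (dvd_refl (x i)) n ?_
    rw [Pi.add_apply, smul_add, smul_frac, smul_frac, smul_frac, LinearMap.add_apply, map_add]
  map_smul' c φ := by
    funext i
    refine smul_pow_injective (dvd_refl (x i)) n ?_
    rw [Pi.smul_apply, smul_comm, smul_frac, smul_frac, LinearMap.smul_apply, map_smul,
      RingHom.id_apply]

theorem smul_comm_apply {R : Type u} [CommRing R] {I : Ideal R} {M : Type u} [AddCommGroup M]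
    [Module R M] (φ : ↥I →ₗ[R] M) (a b : ↥I) : (a : R) • φ b = (b : R) • φ a := by
  rw [← map_smul, ← map_smul]
  exact congrArg φ (Subtype.ext (mul_comm _ _))

theorem rhoLevel_mem {R : Type u} [CommRing R] {k : ℕ} (x : Fin k → R) (M : Type u)
    [AddCommGroup M] [Module R M] (n : ℕ) (φ : ↥(seqIdeal x ^ n) →ₗ[R] M) :
    rhoLevel x M n φ ∈ CechD0 x M := by
  change cechd1 x M _ = 0
  funext ⟨⟨i, j⟩, hij⟩
  have hi : x i ∣ x i * x j := Dvd.intro _ rfl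
  have hj : x j ∣ x i * x j := Dvd.intro_left _ rfl
  refine sub_eq_zero.2 (smul_pow_injective hi n (smul_pow_injective hj n ?_))
  change x j ^ n • x i ^ n • locMap hj M (frac (x j) (φ ⟨x j ^ n, seq_pow_mem x n j⟩) n) =
    x j ^ n • x i ^ n • locMap hi M (frac (x i) (φ ⟨x i ^ n, seq_pow_mem x n i⟩) n)
  rw [smul_comm, ← map_smul (locMap hj M), ← map_smul (locMap hi M), smul_frac, smul_frac,
    locMap_toLoc, locMap_toLoc, ← map_smul (toLoc _ M), ← map_smul (toLoc _ M)]
  exact congrArg (toLoc (x i * x j) M) (smul_comm_apply φ ⟨x i ^ n, seq_pow_mem x n i⟩ ⟨x j ^ n, seq_pow_mem x n j⟩)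

theorem rhoLevel_restrict {R : Type u} [CommRing R] {k : ℕ} (x : Fin k → R) (M : Type u)
    [AddCommGroup M] [Module R M] (m n : ℕ) (h : m ≤ n) (φ : ↥(seqIdeal x ^ m) →ₗ[R] M) :
    rhoLevel x M n (homRestrict (seqIdeal x) M m n h φ) = rhoLevel x M m φ := by
  funext i
  refine smul_pow_injective (dvd_refl (x i)) m (smul_pow_injective (dvd_refl (x i)) n ?_)
  change x i ^ n • x i ^ m • frac (x i) (φ ⟨x i ^ n, _⟩) n =
    x i ^ n • x i ^ m • frac (x i) (φ ⟨x i ^ m, _⟩) m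
  rw [smul_comm, smul_frac, smul_frac, ← map_smul (toLoc _ M), ← map_smul (toLoc _ M)]
  exact congrArg (toLoc (x i) M) (smul_comm_apply φ ⟨x i ^ m, seq_pow_mem x m i⟩
    ⟨x i ^ n, Ideal.pow_le_pow_right h (seq_pow_mem x n i)⟩)

/-- The map `ρ_M` from the ideal transform to the zeroth cohomology of the global Čech complex,
sending the class of `φ : J ^ n → M` to the family `φ (x_i ^ n) / x_i ^ n`. -/
def rho {R : Type u} [CommRing R] {k : ℕ} (x : Fin k → R) (M : Type u)
    [AddCommGroup M] [Module R M] : IdealTransform (seqIdeal x) M →ₗ[R] CechD0 x M :=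
  Module.DirectLimit.lift R ℕ (fun n : ℕ => (↥(seqIdeal x ^ n) →ₗ[R] M))
    (homRestrict (seqIdeal x) M)
    (fun n => (rhoLevel x M n).codRestrict (CechD0 x M) (rhoLevel_mem x M n))
    (fun m n h φ => Subtype.ext (rhoLevel_restrict x M m n h φ))

theorem rho_of {R : Type u} [CommRing R] {k : ℕ} (x : Fin k → R) (M : Type u)
    [AddCommGroup M] [Module R M] (n : ℕ) (φ : ↥(seqIdeal x ^ n) →ₗ[R] M) (i : Fin k) :
    (rho x M (IdealTransform.of (seqIdeal x) M n φ)).1 i =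
      frac (x i) (φ ⟨x i ^ n, seq_pow_mem x n i⟩) n := by
  unfold rho IdealTransform.of
  rw [Module.DirectLimit.lift_of]
  rfl

/-! ### Koszul homology and weakly pro-regular sequences -/

/-- The linear form `e_i ↦ x_i` on the free module with basis `e_1, …, e_k`. -/
def seqForm {R : Type u} [CommRing R] {k : ℕ} (x : Fin k → R) : (Fin k → R) →ₗ[R] R :=
  Fintype.linearCombination R x

/-- The Koszul differential on the exterior algebra of the free module with basis `e_1, …, e_k`:
the contraction with the linear form `e_i ↦ x_i`, that is
`e_{i_0} ∧ ⋯ ∧ e_{i_p} ↦ ∑ (-1) ^ j x_{i_j} e_{i_0} ∧ ⋯ (omit e_{i_j}) ⋯ ∧ e_{i_p}`. -/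
def koszulD {R : Type u} [CommRing R] {k : ℕ} (x : Fin k → R) :
    ExteriorAlgebra R (Fin k → R) →ₗ[R] ExteriorAlgebra R (Fin k → R) :=
  CliffordAlgebra.contractLeft (Q := (0 : QuadraticForm R (Fin k → R))) (seqForm x)

theorem koszulD_one {R : Type u} [CommRing R] {k : ℕ} (x : Fin k → R) : koszulD x 1 = 0 :=
  CliffordAlgebra.contractLeft_one (Q := (0 : QuadraticForm R (Fin k → R))) (d := seqForm x)

theorem koszulD_ι_mul {R : Type u} [CommRing R] {k : ℕ} (x : Fin k → R) (a : Fin k → R)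
    (b : ExteriorAlgebra R (Fin k → R)) :
    koszulD x (ExteriorAlgebra.ι R a * b) =
      seqForm x a • b - ExteriorAlgebra.ι R a * koszulD x b :=
  CliffordAlgebra.contractLeft_ι_mul (seqForm x) a b

theorem koszulD_koszulD {R : Type u} [CommRing R] {k : ℕ} (x : Fin k → R)
    (z : ExteriorAlgebra R (Fin k → R)) : koszulD x (koszulD x z) = 0 :=
  CliffordAlgebra.contractLeft_contractLeft (seqForm x) z

theorem koszulD_mem {R : Type u} [CommRing R] {k : ℕ} (x : Fin k → R) (p : ℕ) :
    ∀ z ∈ ⋀[R]^(p + 1) (Fin k → R), koszulD x z ∈ ⋀[R]^p (Fin k → R) := by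
  induction p with
  | zero =>
    intro z hz
    rw [ExteriorAlgebra.exteriorPower, zero_add, pow_one] at hz
    obtain ⟨a, rfl⟩ := hz
    rw [← mul_one (ExteriorAlgebra.ι R a), koszulD_ι_mul, koszulD_one, mul_zero, sub_zero]
    refine Submodule.smul_mem _ _ ?_
    rw [ExteriorAlgebra.exteriorPower, pow_zero]
    exact Submodule.one_le.1 le_rfl
  | succ p ih =>
    intro z hz
    rw [ExteriorAlgebra.exteriorPower, pow_succ'] at hz
    refine Submodule.mul_induction_on hz ?_ fun a b ha hb => ?_
    · rintro _ ⟨a, rfl⟩ b hb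
      rw [koszulD_ι_mul]
      refine Submodule.sub_mem _ (Submodule.smul_mem _ _ hb) ?_
      rw [ExteriorAlgebra.exteriorPower, pow_succ']
      exact Submodule.mul_mem_mul ⟨a, rfl⟩ (ih b hb)
    · rw [map_add]
      exact Submodule.add_mem _ ha hb

/-- The Koszul cycles of degree `p`. -/
def koszulZ {R : Type u} [CommRing R] {k : ℕ} (x : Fin k → R) (p : ℕ) :
    Submodule R (ExteriorAlgebra R (Fin k → R)) :=
  ⋀[R]^p (Fin k → R) ⊓ LinearMap.ker (koszulD x)

/-- The Koszul boundaries of degree `p`. -/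
def koszulB {R : Type u} [CommRing R] {k : ℕ} (x : Fin k → R) (p : ℕ) :
    Submodule R (ExteriorAlgebra R (Fin k → R)) :=
  (⋀[R]^(p + 1) (Fin k → R)).map (koszulD x)

theorem koszulB_le {R : Type u} [CommRing R] {k : ℕ} (x : Fin k → R) (p : ℕ) :
    koszulB x p ≤ koszulZ x p := by
  rintro _ ⟨z, hz, rfl⟩
  exact ⟨koszulD_mem x p z hz, koszulD_koszulD x z⟩

/-- The Koszul homology of `R` with respect to the sequence `x` in degree `p`: cycles modulo
boundaries. -/
abbrev KoszulH {R : Type u} [CommRing R] {k : ℕ} (x : Fin k → R) (p : ℕ) : Type u :=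
  ↥(koszulZ x p) ⧸ (koszulB x p).submoduleOf (koszulZ x p)

/-- The sequence of `n`-th powers. -/
def powSeq {R : Type u} [CommRing R] {k : ℕ} (x : Fin k → R) (n : ℕ) : Fin k → R :=
  fun i => x i ^ n

/-- The transition map of Koszul complexes from the `m`-th powers to the `n`-th powers, `n ≤ m`:
the algebra map induced by `e_i ↦ x_i ^ (m - n) e_i`. -/
def koszulT {R : Type u} [CommRing R] {k : ℕ} (x : Fin k → R) (m n : ℕ) :
    ExteriorAlgebra R (Fin k → R) →ₐ[R] ExteriorAlgebra R (Fin k → R) :=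
  ExteriorAlgebra.map (LinearMap.pi fun i => x i ^ (m - n) • LinearMap.proj i)

theorem koszulT_mem {R : Type u} [CommRing R] {k : ℕ} (x : Fin k → R) (m n p : ℕ) :
    ∀ z ∈ ⋀[R]^p (Fin k → R), koszulT x m n z ∈ ⋀[R]^p (Fin k → R) := by
  intro z hz
  have h : (⋀[R]^p (Fin k → R)).map (koszulT x m n).toLinearMap ≤ ⋀[R]^p (Fin k → R) := by
    rw [ExteriorAlgebra.exteriorPower, Submodule.map_pow]
    refine pow_le_pow_left' ?_ p
    rintro _ ⟨_, ⟨a, rfl⟩, rfl⟩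
    exact ⟨_, (ExteriorAlgebra.map_apply_ι _ a).symm⟩
  exact h ⟨z, hz, rfl⟩

theorem koszulT_koszulD {R : Type u} [CommRing R] {k : ℕ} (x : Fin k → R) {m n : ℕ} (h : n ≤ m)
    (z : ExteriorAlgebra R (Fin k → R)) :
    koszulT x m n (koszulD (powSeq x m) z) = koszulD (powSeq x n) (koszulT x m n z) := by
  induction z using CliffordAlgebra.left_induction with
  | algebraMap r =>
    rw [Algebra.algebraMap_eq_smul_one, map_smul, map_smul]
    erw [koszulD_one]
    rw [map_zero, smul_zero, map_smul, map_one, map_smul]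
    erw [koszulD_one]
    rw [smul_zero]
  | add a b ha hb => simp only [map_add, ha, hb]
  | ι_mul b a hb =>
    have e1 := koszulD_ι_mul (powSeq x m) a b
    have e2 := koszulD_ι_mul (powSeq x n)
      ((LinearMap.pi fun i => x i ^ (m - n) • LinearMap.proj i : (Fin k → R) →ₗ[R] (Fin k → R)) a)
      (koszulT x m n b)
    have e3 : koszulT x m n (ExteriorAlgebra.ι R a) = ExteriorAlgebra.ι R
      ((LinearMap.pi fun i => x i ^ (m - n) • LinearMap.proj i :
        (Fin k → R) →ₗ[R] (Fin k → R)) a) := ExteriorAlgebra.map_apply_ι _ a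
    have e4 : seqForm (powSeq x n)
      ((LinearMap.pi fun i => x i ^ (m - n) • LinearMap.proj i :
        (Fin k → R) →ₗ[R] (Fin k → R)) a) = seqForm (powSeq x m) a := by
      simp only [seqForm, Fintype.linearCombination_apply, powSeq, LinearMap.pi_apply,
        LinearMap.smul_apply, LinearMap.proj_apply, smul_eq_mul]
      refine Finset.sum_congr rfl fun i _ => ?_
      rw [← pow_sub_mul_pow (x i) h]
      ring
    change koszulT x m n (koszulD (powSeq x m) (ExteriorAlgebra.ι R a * b)) =
      koszulD (powSeq x n) (koszulT x m n (ExteriorAlgebra.ι R a * b))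
    rw [e1, map_mul, map_sub, map_smul, map_mul, e3, e2, e4, hb]

/-- The natural map on Koszul homology from the `m`-th powers to the `n`-th powers, `n ≤ m`. -/
def koszulHMap {R : Type u} [CommRing R] {k : ℕ} (x : Fin k → R) {m n : ℕ} (h : n ≤ m) (p : ℕ) :
    KoszulH (powSeq x m) p →ₗ[R] KoszulH (powSeq x n) p :=
  Submodule.mapQ _ _
    ((koszulT x m n).toLinearMap.restrict (p := koszulZ (powSeq x m) p)
      (q := koszulZ (powSeq x n) p) (fun z hz => ⟨koszulT_mem x m n p z hz.1, by
        have e := koszulT_koszulD x h z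
        rw [LinearMap.mem_ker.1 hz.2, map_zero] at e
        exact e.symm⟩))
    (by
      rintro ⟨_, hz⟩ ⟨w, hw, rfl⟩
      exact ⟨koszulT x m n w, koszulT_mem x m n (p + 1) w hw, (koszulT_koszulD x h w).symm⟩)

/-- The sequence `x` is weakly pro-regular: for every `p > 0` the inverse system of Koszul homology
modules of the powers of `x` is pro-zero. -/
def WeaklyProRegular {R : Type u} [CommRing R] {k : ℕ} (x : Fin k → R) : Prop :=
  ∀ p : ℕ, 0 < p → ∀ n : ℕ, 1 ≤ n → ∃ (m : ℕ) (h : n ≤ m), koszulHMap x h p = 0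

end

end CechLocal

namespace CechLocal

/-! Write `J` for `seqIdeal x`. Since `J` is finitely generated, its powers are cofinal with the
ideals generated by `x_1^n, …, x_k^n` (`exists_pow_le_span_range_pow`). Hence `J`-torsion can be
tested in the localizations at the `x_i`, and so can vanishing in the ideal transform: if all
`φ(x_i^n)/x_i^n` are zero, then `φ` is zero on a smaller power of `J`. This is `rho_injective`.

The map `δ` is explicit on an injective resolution `M → I⁰ → I¹ → ⋯`. Followed by `M → I⁰`, a map `φ
: J^n → M` becomes `r ↦ r y` for some `y ∈ I⁰`, and `δ` sends the class of `φ` to the class of the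
torsion cocycle `dy`. Every torsion cocycle in `I¹` is such a `dy`, and its class vanishes iff `y`
lies in `M + Γ_J(I⁰)`, that is, iff `φ` agrees on a smaller power of `J` with multiplication by an
element of `M`. So `H¹_J(M)` is the cokernel of `τ` (`exists_connecting`,
`exists_natTrans_localCoh`).

As `ρ ∘ τ = d⁰`, the map `ρ` induces `η` on the cokernels of `τ` and `d⁰`; injectivity of `η` and
the isomorphism of cokernels are diagram chases.

Weak pro-regularity serves only for surjectivity of `ρ`. A Čech cocycle is a family `m_i/x_i^n` with
`x_i^n m_j = x_j^n m_i`. A preimage should send `x_i^N` to `x_i^(N-n) m_i`, which must respect the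
syzygies of the `x_i^N`. These are Koszul cycles of degree one; for suitable `N` they become
boundaries at level `n`, and there the `m_i` satisfy the required relations. -/

theorem exists_linearMap_of_ker_le {R F Q M : Type*} [CommRing R] [AddCommGroup F] [Module R F]
    [AddCommGroup Q] [Module R Q] [AddCommGroup M] [Module R M] {p : F →ₗ[R] Q}
    (hp : Function.Surjective p) {g : F →ₗ[R] M} (h : LinearMap.ker p ≤ LinearMap.ker g) :
    ∃ φ : Q →ₗ[R] M, ∀ a, φ (p a) = g a := by
  refine ⟨(LinearMap.ker p).liftQ g h ∘ₗ (p.quotKerEquivOfSurjective hp).symm, fun a => ?_⟩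
  have ha : (p.quotKerEquivOfSurjective hp).symm (p a) = Submodule.Quotient.mk a := by
    rw [LinearEquiv.symm_apply_eq]
    rfl
  rw [LinearMap.comp_apply, LinearEquiv.coe_coe, ha, Submodule.liftQ_apply]

/-! ### Torsion, the ideal transform and the Čech complex -/

section Cech

variable {R : Type u} [CommRing R] {k : ℕ} (x : Fin k → R) (M : Type u) [AddCommGroup M]
  [Module R M]

/-- `J` is finitely generated and contained in the radical of the ideal on the right. -/
theorem exists_pow_le_span_range_pow (n : ℕ) :
    ∃ N : ℕ, seqIdeal x ^ N ≤ Ideal.span (Set.range (powSeq x n)) := by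
  refine Ideal.exists_pow_le_of_le_radical_of_fg ?_ (Submodule.fg_span (Set.finite_range x))
  refine Ideal.span_le.2 ?_
  rintro _ ⟨i, rfl⟩
  exact ⟨n, Ideal.subset_span ⟨i, rfl⟩⟩

variable {M}

theorem toLoc_eq_zero_iff (a : R) (m : M) : toLoc a M m = 0 ↔ ∃ n : ℕ, a ^ n • m = 0 := by
  rw [IsLocalizedModule.eq_zero_iff (Submonoid.powers a) (toLoc a M)]
  constructor
  · rintro ⟨⟨_, n, rfl⟩, h⟩
    exact ⟨n, h⟩
  · rintro ⟨n, h⟩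
    exact ⟨⟨a ^ n, n, rfl⟩, h⟩

/-- Finitely many elements `m_i` that vanish in the localizations at `y_i` are killed by `y_i ^ n` for
a common exponent `n`. -/
theorem exists_forall_pow_smul_eq_zero {ι : Type*} [Finite ι] (y : ι → R) (m : ι → M)
    (h : ∀ i, toLoc (y i) M (m i) = 0) : ∃ n : ℕ, ∀ i, y i ^ n • m i = 0 := by
  cases nonempty_fintype ι
  choose n hn using fun i => (toLoc_eq_zero_iff (y i) (m i)).1 (h i)
  -- The sum serves as a common upper bound of the exponents.
  refine ⟨∑ i, n i, fun i => ?_⟩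
  rw [← pow_sub_mul_pow (y i) (Finset.single_le_sum (f := n) (fun _ _ => Nat.zero_le _)
    (Finset.mem_univ i)), mul_smul, hn, smul_zero]

theorem torsion_eq_cechH0 : torsion (seqIdeal x) M = CechH0 x M := by
  ext m
  constructor
  · rintro ⟨n, hn⟩
    exact funext fun i => (toLoc_eq_zero_iff _ _).2 ⟨n, hn _ (seq_pow_mem x n i)⟩
  · intro h
    obtain ⟨n, hn⟩ := exists_forall_pow_smul_eq_zero x (fun _ => m) fun i => congrFun h i
    obtain ⟨N, hN⟩ := exists_pow_le_span_range_pow x n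
    refine ⟨N, fun r hr => ?_⟩
    have : Ideal.span (Set.range (powSeq x n)) ≤ LinearMap.ker (LinearMap.toSpanSingleton R M m) :=
      Ideal.span_le.2 (by rintro _ ⟨i, rfl⟩; exact hn i)
    exact this (hN hr)

instance directedSystem_homRestrict (J : Ideal R) :
    DirectedSystem (fun n : ℕ => (↥(J ^ n) →ₗ[R] M)) (fun i j h => homRestrict J M i j h) where
  map_self _ _ := rfl
  map_map _ _ _ _ _ _ := rfl

/-- A class in a direct limit is zero iff it dies at a finite stage; for `tau` this says that `r ↦ r
• m` is zero on some `J ^ n`. -/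
theorem exact_torsion_tau (J : Ideal R) :
    Function.Exact (torsion J M).subtype (tau J M) := by
  intro m
  simp only [Submodule.coe_subtype, Subtype.range_coe_subtype, Set.mem_ofPred_eq]
  constructor
  · intro h
    obtain ⟨n, hn, e⟩ := Module.DirectLimit.of.zero_exact h
    exact ⟨n, fun r hr => LinearMap.congr_fun e ⟨r, hr⟩⟩
  · rintro ⟨n, hn⟩
    refine (Module.DirectLimit.of_f (hij := Nat.zero_le n)).symm.trans ?_
    refine Eq.trans (congrArg _ ?_) (map_zero _)
    ext r
    exact hn r r.2

theorem rho_tau (m : M) : rho x M (tau (seqIdeal x) M m) = cechAug x M m := by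
  refine Subtype.ext (funext fun i => ?_)
  refine (rho_of x M 0 _ i).trans (smul_pow_injective (dvd_refl (x i)) 0 ?_)
  rw [smul_frac]
  simp [cechAug, cechd0]

theorem rho_injective : Function.Injective (rho x M) := by
  rw [injective_iff_map_eq_zero]
  intro z hz
  obtain ⟨n, φ, rfl⟩ := Module.DirectLimit.exists_of z
  have h0 (i : Fin k) : toLoc (x i) M (φ ⟨x i ^ n, seq_pow_mem x n i⟩) = 0 := by
    have h := (rho_of x M n φ i).symm.trans (congrFun (congrArg Subtype.val hz) i)
    rw [← smul_frac (x i) _ n, h]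
    exact smul_zero _
  obtain ⟨l, hl⟩ := exists_forall_pow_smul_eq_zero x _ h0
  -- On the ideal generated by the `x_i ^ (n + l)`, the map `φ` vanishes because `φ (x_i ^ (n + l))
  -- = x_i ^ l • φ (x_i ^ n) = 0`.
  obtain ⟨N, hN⟩ := exists_pow_le_span_range_pow x (n + l)
  have hle : n ≤ n + N := Nat.le_add_right n N
  refine (Module.DirectLimit.of_f (hij := hle)).symm.trans ?_
  refine Eq.trans (congrArg _ ?_) (map_zero _)
  ext ⟨r, hr⟩
  have hr' : r ∈ Ideal.span (Set.range (powSeq x (n + l))) :=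
    hN (Ideal.pow_le_pow_right (Nat.le_add_left N n) hr)
  obtain ⟨c, rfl⟩ := (Ideal.mem_span_range_iff_exists_fun).1 hr'
  have : (⟨∑ i, c i * powSeq x (n + l) i, Ideal.pow_le_pow_right hle hr⟩ : ↥(seqIdeal x ^ n)) =
      ∑ i, (c i * x i ^ l) • ⟨x i ^ n, seq_pow_mem x n i⟩ := by
    refine Subtype.ext ?_
    rw [AddSubmonoidClass.coe_finsetSum]
    change ∑ i, c i * powSeq x (n + l) i = _
    refine Finset.sum_congr rfl fun i _ => ?_
    simp only [powSeq, SetLike.val_smul, smul_eq_mul]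
    ring
  change φ ⟨∑ i, c i * powSeq x (n + l) i, Ideal.pow_le_pow_right hle hr⟩ = 0
  rw [this, map_sum]
  exact Finset.sum_eq_zero fun i _ => by rw [map_smul, mul_smul, hl, smul_zero]

theorem exact_cechH0_cechAug : Function.Exact (CechH0 x M).subtype (cechAug x M) := by
  intro m
  simp only [Submodule.coe_subtype, Subtype.range_coe_subtype, Set.mem_ofPred_eq]
  exact Subtype.ext_iff

theorem exact_cechAug_cechProj : Function.Exact (cechAug x M) (cechProj x M) :=
  LinearMap.exact_map_mkQ_range _

theorem cechProj_surjective : Function.Surjective (cechProj x M) :=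
  Submodule.mkQ_surjective _

end Cech

/-! ### Koszul syzygies and surjectivity of `ρ` -/

section WeaklyProRegular

variable {R : Type u} [CommRing R] {k : ℕ} {x : Fin k → R} {M : Type u} [AddCommGroup M]
  [Module R M]

/-- A linear form `e_i ↦ m_i` with `x_i m_j = x_j m_i` vanishes on Koszul boundaries of
degree one. -/
theorem exists_ι_eq_of_mem_koszulB (m : Fin k → M) (hm : ∀ i j, x i • m j = x j • m i)
    {z : ExteriorAlgebra R (Fin k → R)} (hz : z ∈ koszulB x 1) :
    ∃ v : Fin k → R, z = ExteriorAlgebra.ι R v ∧ ∑ i, v i • m i = 0 := by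
  obtain ⟨w, hw, rfl⟩ := hz
  rw [SetLike.mem_coe, ExteriorAlgebra.exteriorPower, pow_succ', pow_one] at hw
  refine Submodule.mul_induction_on hw ?_ ?_
  · rintro _ ⟨a, rfl⟩ _ ⟨b, rfl⟩
    have hb : koszulD x (ExteriorAlgebra.ι R b) = seqForm x b • 1 := by
      rw [← mul_one (ExteriorAlgebra.ι R b), koszulD_ι_mul, koszulD_one, mul_zero, sub_zero]
    -- This vector is the Koszul differential of `a ∧ b`; the form takes on it the value `∑ a_i b_j
    -- (x_i m_j - x_j m_i)`.
    refine ⟨seqForm x a • b - seqForm x b • a, ?_, ?_⟩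
    · rw [koszulD_ι_mul, hb, map_sub, map_smul, map_smul, mul_smul_comm, mul_one]
    · rw [← Fintype.linearCombination_apply R m, map_sub, map_smul, map_smul, sub_eq_zero]
      simp only [seqForm, Fintype.linearCombination_apply, smul_eq_mul, Finset.sum_smul,
        Finset.smul_sum]
      rw [Finset.sum_comm]
      refine Finset.sum_congr rfl fun i _ => Finset.sum_congr rfl fun j _ => ?_
      rw [mul_smul, mul_smul, smul_comm (x i) (b j), hm i j, smul_comm (x j) (a i),
        smul_comm (a i) (b j)]
  · rintro y z ⟨v, hv, hv'⟩ ⟨w, hw, hw'⟩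
    refine ⟨v + w, by rw [map_add, map_add, hv, hw], ?_⟩
    simp only [Pi.add_apply, add_smul, Finset.sum_add_distrib, hv', hw', add_zero]

/-- A syzygy `a` of the `x_i ^ N` is a Koszul 1-cycle, and the transition map sends it to the vector
`a_i x_i ^ (N - n)`. Once this is a boundary for the `x_i ^ n`, the form `e_i ↦ m_i` kills it. -/
theorem WeaklyProRegular.exists_sum_smul_eq_zero (hx : WeaklyProRegular x) {n : ℕ} (hn : 1 ≤ n)
    (m : Fin k → M) (hm : ∀ i j, x i ^ n • m j = x j ^ n • m i) :
    ∃ N : ℕ, n ≤ N ∧ ∀ a : Fin k → R, ∑ i, a i * x i ^ N = 0 →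
      ∑ i, (a i * x i ^ (N - n)) • m i = 0 := by
  obtain ⟨N, hN, h⟩ := hx 1 one_pos n hn
  refine ⟨N, hN, fun a ha => ?_⟩
  have hmem : ExteriorAlgebra.ι R a ∈ koszulZ (powSeq x N) 1 := by
    refine ⟨?_, ?_⟩
    · rw [ExteriorAlgebra.exteriorPower, pow_one]
      exact ⟨a, rfl⟩
    · rw [SetLike.mem_coe, LinearMap.mem_ker, ← mul_one (ExteriorAlgebra.ι R a), koszulD_ι_mul,
        koszulD_one, mul_zero, sub_zero]
      simp only [seqForm, Fintype.linearCombination_apply, powSeq, smul_eq_mul, ha, zero_smul]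
  have h' := LinearMap.congr_fun h (Submodule.Quotient.mk ⟨_, hmem⟩)
  rw [koszulHMap, Submodule.mapQ_apply, LinearMap.zero_apply, Submodule.Quotient.mk_eq_zero] at h'
  have hB : koszulT x N n (ExteriorAlgebra.ι R a) ∈ koszulB (powSeq x n) 1 :=
    h'
  obtain ⟨v, hv, hv'⟩ := exists_ι_eq_of_mem_koszulB m hm hB
  rw [koszulT, ExteriorAlgebra.map_apply_ι, ExteriorAlgebra.ι_inj] at hv
  rw [← hv', ← hv]
  exact Finset.sum_congr rfl fun i _ => by simp [mul_comm]

/-- A linear map on the ideal generated by `y` with prescribed values on the generators, as long as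
these respect the relations. -/
theorem exists_linearMap_span (y : Fin k → R) (m : Fin k → M)
    (h : ∀ a : Fin k → R, ∑ i, a i * y i = 0 → ∑ i, a i • m i = 0) :
    ∃ φ : ↥(Ideal.span (Set.range y)) →ₗ[R] M,
      ∀ i, φ ⟨y i, Ideal.subset_span ⟨i, rfl⟩⟩ = m i := by
  have hrange : LinearMap.range (Fintype.linearCombination R y) = Ideal.span (Set.range y) :=
    Fintype.range_linearCombination R y
  let p : (Fin k → R) →ₗ[R] ↥(Ideal.span (Set.range y)) :=
    (Fintype.linearCombination R y).codRestrict _ fun a => hrange ▸ ⟨a, rfl⟩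
  have hp : Function.Surjective p := by
    rintro ⟨r, hr⟩
    obtain ⟨a, ha⟩ := hrange.symm ▸ hr
    exact ⟨a, Subtype.ext ha⟩
  have hker : LinearMap.ker p ≤ LinearMap.ker (Fintype.linearCombination R m) := by
    intro a ha
    simpa [Fintype.linearCombination_apply] using h a (by
      exact congrArg Subtype.val ha)
  obtain ⟨φ, hφ⟩ := exists_linearMap_of_ker_le hp hker
  refine ⟨φ, fun i => ?_⟩
  have hi : (⟨y i, Ideal.subset_span ⟨i, rfl⟩⟩ : ↥(Ideal.span (Set.range y))) =
      p (Pi.single i 1) :=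
    Subtype.ext (by simp [p])
  rw [hi, hφ]
  simp

/-- Finitely many elements of localizations have fractions with a common exponent. -/
theorem exists_eq_frac (f : Cech1 x M) :
    ∃ (n : ℕ) (m : Fin k → M), ∀ i, f i = frac (x i) (m i) n := by
  have h (i : Fin k) : ∃ (n : ℕ) (m : M), f i = frac (x i) m n := by
    induction f i using LocalizedModule.induction_on with
    | h m s => obtain ⟨_, n, rfl⟩ := s; exact ⟨n, m, rfl⟩
  choose n m hm using h
  refine ⟨∑ i, n i, fun i => x i ^ (∑ i, n i - n i) • m i, fun i => ?_⟩
  have hle : n i ≤ ∑ i, n i :=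
    Finset.single_le_sum (f := n) (fun _ _ => Nat.zero_le _) (Finset.mem_univ i)
  refine smul_pow_injective (dvd_refl (x i)) (∑ i, n i) ?_
  rw [smul_frac, hm, ← pow_sub_mul_pow (x i) hle, mul_smul, smul_frac, map_smul]

theorem frac_smul (a : R) (m : M) (n l : ℕ) : frac a (a ^ l • m) (n + l) = frac a m n := by
  refine smul_pow_injective (dvd_refl a) (n + l) ?_
  rw [smul_frac, pow_add, mul_comm, mul_smul, smul_frac, map_smul]

/-- The compatible fractions in a Čech cocycle can be chosen to agree before localization. -/
theorem exists_eq_frac_of_mem_cechD0 {f : Cech1 x M} (hf : f ∈ CechD0 x M) :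
    ∃ (n : ℕ) (m : Fin k → M), 1 ≤ n ∧ (∀ i, f i = frac (x i) (m i) n) ∧
      ∀ i j, x i ^ n • m j = x j ^ n • m i := by
  obtain ⟨n, m, hm⟩ := exists_eq_frac f
  have key (p : {p : Fin k × Fin k // p.1 < p.2}) :
      toLoc (x p.1.1 * x p.1.2) M (x p.1.1 ^ n • m p.1.2 - x p.1.2 ^ n • m p.1.1) = 0 := by
    obtain ⟨⟨i, j⟩, hij⟩ := p
    have hi : x i ∣ x i * x j := Dvd.intro _ rfl
    have hj : x j ∣ x i * x j := Dvd.intro_left _ rfl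
    have h : locMap hj M (f j) = locMap hi M (f i) := sub_eq_zero.1 (congrFun hf ⟨⟨i, j⟩, hij⟩)
    have h2 := congrArg (fun z => x j ^ n • x i ^ n • z) h
    simp only [hm] at h2
    rw [smul_comm, ← map_smul (locMap hj M), ← map_smul (locMap hi M), smul_frac, smul_frac,
      locMap_toLoc, locMap_toLoc, ← map_smul, ← map_smul] at h2
    rw [map_sub, sub_eq_zero]
    exact h2
  obtain ⟨l, hl⟩ := exists_forall_pow_smul_eq_zero _ _ key
  -- The exponent is `l + 1` rather than `l` so that `n + (l + 1)` is positive, as weak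
  -- pro-regularity speaks only of positive powers.
  have hlt (i j : Fin k) (hij : i < j) :
      x i ^ (n + (l + 1)) • x j ^ (l + 1) • m j = x j ^ (n + (l + 1)) • x i ^ (l + 1) • m i := by
    have h := congrArg (fun z => (x i * x j) • z) (hl ⟨⟨i, j⟩, hij⟩)
    simp only [smul_sub, smul_zero, sub_eq_zero, smul_smul] at h
    rw [smul_smul, smul_smul]
    convert h using 2 <;> ring
  refine ⟨n + (l + 1), fun i => x i ^ (l + 1) • m i, by omega, fun i => ?_, fun i j => ?_⟩
  · rw [frac_smul, hm]
  · rcases lt_trichotomy i j with h | rfl | h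
    · exact hlt i j h
    · rfl
    · exact (hlt j i h).symm

theorem WeaklyProRegular.rho_surjective (hx : WeaklyProRegular x) :
    Function.Surjective (rho x M) := by
  rintro ⟨f, hf⟩
  obtain ⟨n, m, hn, hfm, hm⟩ := exists_eq_frac_of_mem_cechD0 hf
  obtain ⟨N, hN, h⟩ := hx.exists_sum_smul_eq_zero hn m hm
  obtain ⟨φ, hφ⟩ := exists_linearMap_span (powSeq x N) (fun i => x i ^ (N - n) • m i)
    fun a ha => by simpa only [smul_smul] using h a ha
  obtain ⟨L, hL⟩ := exists_pow_le_span_range_pow x N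
  have hle : seqIdeal x ^ (N + L) ≤ Ideal.span (Set.range (powSeq x N)) :=
    (Ideal.pow_le_pow_right (Nat.le_add_left L N)).trans hL
  -- `φ` lives on the ideal generated by the `x_i ^ N`, so it is restricted to a power of `J` inside
  -- it. Taking `N + L` rather than `L` lets the fractions be compared by cancelling `x_i ^ L`.
  refine ⟨IdealTransform.of _ M (N + L) (φ ∘ₗ Submodule.inclusion hle),
    Subtype.ext (funext fun i => ?_)⟩
  rw [rho_of]
  refine Eq.trans ?_ (hfm i).symm
  have : Submodule.inclusion hle ⟨x i ^ (N + L), seq_pow_mem x (N + L) i⟩ =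
      x i ^ L • ⟨powSeq x N i, Ideal.subset_span ⟨i, rfl⟩⟩ :=
    Subtype.ext (by simp [powSeq, pow_add, mul_comm])
  rw [LinearMap.comp_apply, this, map_smul, hφ, frac_smul]
  obtain ⟨d, rfl⟩ := Nat.exists_eq_add_of_le hN
  rw [Nat.add_sub_cancel_left, frac_smul]

end WeaklyProRegular

noncomputable section

/-! ### The cokernel of `τ` through an embedding of `M` -/

section Connecting

variable {R : Type u} [CommRing R] (J : Ideal R) {M I H : Type u} [AddCommGroup M] [Module R M]
  [AddCommGroup I] [Module R I] [AddCommGroup H] [Module R H]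

/-- The elements of `I` that some power of `J` multiplies into the image of `M`. -/
def transporter (ε : M →ₗ[R] I) : Submodule R I :=
  (torsion J (I ⧸ LinearMap.range ε)).comap (LinearMap.range ε).mkQ

variable {J}

theorem mem_transporter {ε : M →ₗ[R] I} {y : I} :
    y ∈ transporter J ε ↔ ∃ n : ℕ, ∀ r ∈ J ^ n, ∃ m, ε m = r • y := by
  refine exists_congr fun n => forall₂_congr fun r _ => ?_
  rw [← map_smul, Submodule.mkQ_apply, Submodule.Quotient.mk_eq_zero]
  rfl

theorem mem_transporter_of_forall {ε : M →ₗ[R] I} {n : ℕ} {φ : ↥(J ^ n) →ₗ[R] M} {y : I}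
    (h : ∀ r : ↥(J ^ n), (r : R) • y = ε (φ r)) : y ∈ transporter J ε :=
  mem_transporter.2 ⟨n, fun r hr => ⟨φ ⟨r, hr⟩, (h ⟨r, hr⟩).symm⟩⟩

/-- The connecting homomorphism from the ideal transform: if maps from powers of `J` extend along
`ε : M → I`, and `H` is the quotient of the transporter by the sum of `M` and the torsion of `I`,
then `H` is the cokernel of `tau`. -/
theorem exists_connecting {ε : M →ₗ[R] I} (hε : Function.Injective ε)
    (hI : ∀ (n : ℕ) (φ : ↥(J ^ n) →ₗ[R] M), ∃ y : I, ∀ r : ↥(J ^ n), (r : R) • y = ε (φ r))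
    {c : transporter J ε →ₗ[R] H} (hc : Function.Surjective c)
    (hker : ∀ w, c w = 0 ↔ ∃ m, (w : I) - ε m ∈ torsion J I) :
    ∃ δ : IdealTransform J M →ₗ[R] H,
      (∀ (n : ℕ) (φ : ↥(J ^ n) →ₗ[R] M) (y : I) (h : ∀ r : ↥(J ^ n), (r : R) • y = ε (φ r)),
        δ (IdealTransform.of J M n φ) = c ⟨y, mem_transporter_of_forall h⟩) ∧
      Function.Exact (tau J M) δ ∧ Function.Surjective δ := by
  choose Y hY using hI
  -- Two extensions of the same map differ by an element killed by `J ^ n`, which `c` ignores; this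
  -- makes the chosen `Y` linear and compatible with restriction after applying `c`.
  have key (n : ℕ) (φ : ↥(J ^ n) →ₗ[R] M) (y : transporter J ε)
      (h : ∀ r ∈ J ^ n, r • ((Y n φ : I) - y) = 0) :
      c ⟨Y n φ, mem_transporter_of_forall (hY n φ)⟩ = c y := by
    rw [← sub_eq_zero, ← map_sub]
    exact (hker _).2 ⟨0, n, fun r hr => by simpa using h r hr⟩
  let δn (n : ℕ) : (↥(J ^ n) →ₗ[R] M) →ₗ[R] H :=
    { toFun := fun φ => c ⟨Y n φ, mem_transporter_of_forall (hY n φ)⟩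
      map_add' := fun φ ψ => by
        rw [← map_add]
        refine key n _ _ fun r hr => ?_
        have h1 := hY n (φ + ψ) ⟨r, hr⟩
        have h2 := hY n φ ⟨r, hr⟩
        have h3 := hY n ψ ⟨r, hr⟩
        simp only [Submodule.coe_add, smul_sub, smul_add] at h1 h2 h3 ⊢
        rw [h1, h2, h3, LinearMap.add_apply, map_add, sub_self]
      map_smul' := fun a φ => by
        rw [RingHom.id_apply, ← map_smul]
        refine key n _ _ fun r hr => ?_
        have h1 := hY n (a • φ) ⟨r, hr⟩
        have h2 := hY n φ ⟨r, hr⟩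
        simp only [Submodule.coe_smul, smul_sub] at h1 h2 ⊢
        rw [h1, smul_comm, h2, LinearMap.smul_apply, map_smul, sub_self] }
  let δ : IdealTransform J M →ₗ[R] H :=
    Module.DirectLimit.lift R ℕ (fun n : ℕ => (↥(J ^ n) →ₗ[R] M)) (homRestrict J M) δn
      fun m n h φ => key n _ _ fun r hr => by
        have h1 := hY n (homRestrict J M m n h φ) ⟨r, hr⟩
        have h2 := hY m φ ⟨r, Ideal.pow_le_pow_right h hr⟩
        simp only [smul_sub] at h1 h2 ⊢
        rw [h1, h2, sub_eq_zero]
        rfl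
  have hδ (n : ℕ) (φ : ↥(J ^ n) →ₗ[R] M) (y : I)
      (h : ∀ r : ↥(J ^ n), (r : R) • y = ε (φ r)) :
      δ (IdealTransform.of J M n φ) = c ⟨y, mem_transporter_of_forall h⟩ :=
    (Module.DirectLimit.lift_of ..).trans <| key n φ _ fun r hr => by
      rw [smul_sub, sub_eq_zero]
      exact (hY n φ ⟨r, hr⟩).trans (h ⟨r, hr⟩).symm
  refine ⟨δ, hδ, fun z => ⟨fun hz => ?_, ?_⟩, fun a => ?_⟩
  · obtain ⟨n, φ, rfl⟩ := Module.DirectLimit.exists_of z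
    have h := (hδ n φ (Y n φ) (hY n φ)).symm.trans hz
    obtain ⟨m, l, hl⟩ := (hker _).1 h
    refine ⟨m, ?_⟩
    -- On `J ^ (n + l)` both facts apply: `φ` is multiplication by `Y n φ`, and `Y n φ - ε m` is
    -- annihilated.
    refine (Module.DirectLimit.of_f (hij := Nat.zero_le (n + l))).symm.trans
      (Eq.trans (congrArg _ ?_) (Module.DirectLimit.of_f (hij := Nat.le_add_right n l)))
    ext ⟨r, hr⟩
    have h1 := hl r (Ideal.pow_le_pow_right (Nat.le_add_left l n) hr)
    rw [smul_sub, hY n φ ⟨r, Ideal.pow_le_pow_right (Nat.le_add_right n l) hr⟩, sub_eq_zero,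
      ← map_smul] at h1
    exact (hε h1).symm
  · rintro ⟨m, rfl⟩
    refine (hδ 0 _ (ε m) fun r => ?_).trans ((hker _).2 ⟨m, ?_⟩)
    · exact (map_smul ε _ m).symm
    · rw [sub_self]
      exact zero_mem _
  · obtain ⟨⟨y, hy⟩, rfl⟩ := hc a
    obtain ⟨n, hn⟩ := mem_transporter.1 hy
    let e := LinearEquiv.ofInjective ε hε
    -- A preimage of `c y` is the class of `r ↦ ε⁻¹(r • y)`.
    let φ : ↥(J ^ n) →ₗ[R] M := e.symm.toLinearMap ∘ₗ
      (LinearMap.toSpanSingleton R I y ∘ₗ (J ^ n).subtype).codRestrict (LinearMap.range ε)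
        fun r => hn r r.2
    refine ⟨IdealTransform.of J M n φ, hδ n φ y fun r => ?_⟩
    exact (congrArg Subtype.val (e.apply_symm_apply ⟨(r : R) • y, hn r r.2⟩)).symm

end Connecting

/-! ### Elementwise description of first cohomology -/

section Homology

variable {R : Type u} [CommRing R]

/-- The cycle given by a cocycle of degree one of a cochain complex of modules. -/
def cycleOfKer (K : CochainComplex (ModuleCat.{u} R) ℕ) :
    LinearMap.ker (K.d 1 2).hom →ₗ[R] K.cycles 1 :=
  (K.liftCycles (ModuleCat.ofHom (LinearMap.ker (K.d 1 2).hom).subtype) 2 (by simp)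
    (by ext z; exact z.2)).hom

theorem iCycles_cycleOfKer (K : CochainComplex (ModuleCat.{u} R) ℕ)
    (z : LinearMap.ker (K.d 1 2).hom) : (K.iCycles 1).hom (cycleOfKer K z) = z := by
  rw [cycleOfKer, ← ModuleCat.comp_apply, K.liftCycles_i]
  rfl

/-- The class in the homology of a cochain complex of modules of a cocycle of degree one. -/
def homologyClass (K : CochainComplex (ModuleCat.{u} R) ℕ) :
    LinearMap.ker (K.d 1 2).hom →ₗ[R] K.homology 1 :=
  (K.homologyπ 1).hom ∘ₗ cycleOfKer K

theorem iCycles_injective (K : CochainComplex (ModuleCat.{u} R) ℕ) (i : ℕ) :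
    Function.Injective (K.iCycles i).hom :=
  (ModuleCat.mono_iff_injective _).1 inferInstance

theorem homologyClass_surjective (K : CochainComplex (ModuleCat.{u} R) ℕ) :
    Function.Surjective (homologyClass K) := by
  intro a
  obtain ⟨b, rfl⟩ := (ModuleCat.epi_iff_surjective (K.homologyπ 1)).1 inferInstance a
  refine ⟨⟨(K.iCycles 1).hom b, ?_⟩, ?_⟩
  · rw [LinearMap.mem_ker, ← ModuleCat.comp_apply, K.iCycles_d]
    rfl
  · refine congrArg (K.homologyπ 1).hom (iCycles_injective K 1 ?_)
    exact iCycles_cycleOfKer K _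

theorem homologyClass_eq_zero_iff (K : CochainComplex (ModuleCat.{u} R) ℕ)
    (z : LinearMap.ker (K.d 1 2).hom) :
    homologyClass K z = 0 ↔ ∃ w, (K.d 0 1).hom w = z := by
  have hex : (ShortComplex.mk _ _ (K.toCycles_comp_homologyπ 0 1)).Exact :=
    ShortComplex.exact_of_g_is_cokernel _ (K.homologyIsCokernel 0 1 (by simp))
  rw [ShortComplex.moduleCat_exact_iff] at hex
  constructor
  · intro h
    obtain ⟨w, hw⟩ := hex _ h
    refine ⟨w, ?_⟩
    rw [← iCycles_cycleOfKer K z, ← K.toCycles_i 0 1]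
    exact congrArg (K.iCycles 1).hom hw
  · rintro ⟨w, hw⟩
    refine (congrArg (K.homologyπ 1).hom (iCycles_injective K 1
      (a₂ := (K.toCycles 0 1).hom w) ?_)).trans ?_
    · rw [iCycles_cycleOfKer, ← hw, ← K.toCycles_i 0 1]
      rfl
    · rw [← ModuleCat.comp_apply, K.toCycles_comp_homologyπ]
      rfl

theorem homologyMap_homologyClass {K L : CochainComplex (ModuleCat.{u} R) ℕ} (f : K ⟶ L)
    (z : LinearMap.ker (K.d 1 2).hom) (z' : LinearMap.ker (L.d 1 2).hom)
    (h : (f.f 1).hom z = z') :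
    (HomologicalComplex.homologyMap f 1).hom (homologyClass K z) = homologyClass L z' := by
  change (K.homologyπ 1 ≫ HomologicalComplex.homologyMap f 1).hom _ = _
  rw [HomologicalComplex.homologyπ_naturality]
  refine congrArg (L.homologyπ 1).hom (iCycles_injective L 1 ?_)
  rw [iCycles_cycleOfKer, ← h, ← iCycles_cycleOfKer K z, ← ModuleCat.comp_apply,
    ← HomologicalComplex.cyclesMap_i]
  rfl

end Homology

end

noncomputable section

/-! ### First local cohomology from an injective resolution -/

section Resolution

variable {R : Type u} [CommRing R] (J : Ideal R) {M N : ModuleCat.{u} R}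
  (I : InjectiveResolution M) (I' : InjectiveResolution N)

/-- The augmentation of an injective resolution as a linear map. -/
def augmentation : M →ₗ[R] I.cocomplex.X 0 :=
  ModuleCat.Hom.hom (A := M) (I.ι.f 0)

theorem augmentation_injective : Function.Injective (augmentation I) :=
  (ModuleCat.mono_iff_injective (I.ι.f 0)).1 inferInstance

theorem exact_augmentation : Function.Exact (augmentation I) (I.cocomplex.d 0 1).hom := by
  intro y
  constructor
  · exact (ShortComplex.moduleCat_exact_iff _).1 I.exact₀ y
  · rintro ⟨m, rfl⟩
    exact LinearMap.congr_fun (congrArg ModuleCat.Hom.hom I.ι_f_zero_comp_complex_d) m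

theorem exact_resolution (n : ℕ) :
    Function.Exact (I.cocomplex.d n (n + 1)).hom (I.cocomplex.d (n + 1) (n + 2)).hom := by
  intro y
  constructor
  · exact (ShortComplex.moduleCat_exact_iff _).1 (I.exact_succ n) y
  · rintro ⟨m, rfl⟩
    rw [← ModuleCat.comp_apply, I.complex_d_comp]
    rfl

variable {J}

/-- By injectivity the map `J ^ n → M → I⁰` extends to `R`; `y` is the image of `1`. -/
theorem exists_smul_eq_augmentation {n : ℕ} (φ : ↥(J ^ n) →ₗ[R] M) :
    ∃ y : I.cocomplex.X 0, ∀ r : ↥(J ^ n), (r : R) • y = augmentation I (φ r) := by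
  let i : ModuleCat.of R ↥(J ^ n) ⟶ ModuleCat.of R R := ModuleCat.ofHom (J ^ n).subtype
  have : Mono i := (ModuleCat.mono_iff_injective i).2 Subtype.val_injective
  let g : ModuleCat.of R ↥(J ^ n) ⟶ I.cocomplex.X 0 := ModuleCat.ofHom (augmentation I ∘ₗ φ)
  refine ⟨(Injective.factorThru g i).hom 1, fun r => ?_⟩
  rw [← map_smul, smul_eq_mul, mul_one]
  exact LinearMap.congr_fun (congrArg ModuleCat.Hom.hom (Injective.comp_factorThru g i)) r

/-- By exactness at `I⁰`, `r • dy = 0` iff `r • y` comes from `M`. -/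
theorem d_mem_torsion_iff {y : I.cocomplex.X 0} :
    (I.cocomplex.d 0 1).hom y ∈ torsion J (I.cocomplex.X 1) ↔
      y ∈ transporter J (augmentation I) := by
  rw [mem_transporter]
  refine exists_congr fun n => forall₂_congr fun r _ => ?_
  rw [← map_smul]
  exact exact_augmentation I (r • y)

variable (J)

/-- The torsion of an injective resolution. -/
abbrev torsionComplex : CochainComplex (ModuleCat.{u} R) ℕ :=
  ((torsionFunctor J).mapHomologicalComplex _).obj I.cocomplex

/-- The differential from the transporter to the torsion cocycles of degree one. -/
def transporterToKer :
    transporter J (augmentation I) →ₗ[R] LinearMap.ker ((torsionComplex J I).d 1 2).hom :=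
  LinearMap.codRestrict _
    (((I.cocomplex.d 0 1).hom ∘ₗ (transporter J (augmentation I)).subtype).codRestrict
      (torsion J (I.cocomplex.X 1)) fun w => (d_mem_torsion_iff I).2 w.2)
    fun w => Subtype.ext ((exact_resolution I 0 _).2 ⟨w, rfl⟩)

theorem transporterToKer_surjective : Function.Surjective (transporterToKer J I) := by
  rintro ⟨⟨z, hz⟩, hz'⟩
  obtain ⟨y, rfl⟩ := (exact_resolution I 0 z).1 (congrArg Subtype.val hz')
  exact ⟨⟨y, (d_mem_torsion_iff I).1 hz⟩, rfl⟩

/-- The map from the transporter to the first local cohomology. -/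
def transporterClass : transporter J (augmentation I) →ₗ[R] (localCoh J 1).obj M :=
  (I.isoRightDerivedObj (torsionFunctor J) 1).inv.hom ∘ₗ
    homologyClass (torsionComplex J I) ∘ₗ transporterToKer J I

theorem isoRightDerivedObj_inv_injective :
    Function.Injective (I.isoRightDerivedObj (torsionFunctor J) 1).inv.hom :=
  (ModuleCat.mono_iff_injective _).1 inferInstance

theorem transporterClass_surjective : Function.Surjective (transporterClass J I) :=
  ((ModuleCat.epi_iff_surjective (I.isoRightDerivedObj (torsionFunctor J) 1).inv).1
    inferInstance).comp
    ((homologyClass_surjective _).comp (transporterToKer_surjective J I))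

/-- The class vanishes iff `dw = dt` for some torsion element `t`, and then `w - t` comes from `M`
by exactness. -/
theorem transporterClass_eq_zero_iff (w : transporter J (augmentation I)) :
    transporterClass J I w = 0 ↔
      ∃ m, (w : I.cocomplex.X 0) - augmentation I m ∈ torsion J (I.cocomplex.X 0) := by
  have h : transporterClass J I w = 0 ↔ homologyClass _ (transporterToKer J I w) = 0 :=
    map_eq_zero_iff (I.isoRightDerivedObj (torsionFunctor J) 1).inv.hom
      (isoRightDerivedObj_inv_injective J I)
  rw [h, homologyClass_eq_zero_iff]
  constructor
  · rintro ⟨⟨t, ht⟩, e⟩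
    have e' : (I.cocomplex.d 0 1).hom t = (I.cocomplex.d 0 1).hom w := congrArg Subtype.val e
    obtain ⟨m, hm⟩ := (exact_augmentation I (w - t)).1 (by rw [map_sub, e', sub_self])
    exact ⟨m, by rwa [hm, sub_sub_cancel]⟩
  · rintro ⟨m, hm⟩
    refine ⟨⟨_, hm⟩, Subtype.ext ?_⟩
    change (I.cocomplex.d 0 1).hom (w - augmentation I m) = (I.cocomplex.d 0 1).hom w
    rw [map_sub, (exact_augmentation I _).2 ⟨m, rfl⟩, sub_zero]

variable {I I'}

theorem localCoh_map_transporterClass (f : M ⟶ N) (g : I.cocomplex ⟶ I'.cocomplex)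
    (comm : I.ι.f 0 ≫ g.f 0 = f ≫ I'.ι.f 0) (w : transporter J (augmentation I))
    (w' : transporter J (augmentation I')) (h : (g.f 0).hom w = w') :
    ((localCoh J 1).map f).hom (transporterClass J I w) = transporterClass J I' w' := by
  have e := InjectiveResolution.isoRightDerivedObj_inv_naturality f I I' g comm
    (torsionFunctor J) 1
  refine (LinearMap.congr_fun (congrArg ModuleCat.Hom.hom e) _).trans ?_
  refine congrArg (I'.isoRightDerivedObj (torsionFunctor J) 1).inv.hom ?_
  refine homologyMap_homologyClass (((torsionFunctor J).mapHomologicalComplex _).map g) _ _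
    (Subtype.ext ?_)
  change (g.f 1).hom ((I.cocomplex.d 0 1).hom w) = (I'.cocomplex.d 0 1).hom w'
  rw [← h, ← ModuleCat.comp_apply, ← ModuleCat.comp_apply, g.comm]

end Resolution

/-! ### Naturality of the connecting map -/

variable {R : Type u} [CommRing R]

/-- The connecting natural transformation from the ideal transform to local cohomology. -/
theorem exists_natTrans_localCoh (J : Ideal R) :
    ∃ δ : idealTransformFunctor J ⟶ localCoh J 1, ∀ M : ModuleCat.{u} R,
      Function.Exact (tau J M) (δ.app M).hom ∧ Function.Surjective (δ.app M).hom := by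
  choose δ hδ hex hsurj using fun M : ModuleCat.{u} R =>
    exists_connecting (augmentation_injective (injectiveResolution M))
      (fun _ φ => exists_smul_eq_augmentation (injectiveResolution M) φ)
      (transporterClass_surjective J (injectiveResolution M))
      (transporterClass_eq_zero_iff J (injectiveResolution M))
  refine ⟨{ app := fun M => ModuleCat.ofHom (δ M), naturality := fun M N f => ?_ },
    fun M => ⟨hex M, hsurj M⟩⟩
  refine ModuleCat.hom_ext (LinearMap.ext fun z => ?_)
  obtain ⟨n, φ, rfl⟩ := Module.DirectLimit.exists_of z
  obtain ⟨y, hy⟩ := exists_smul_eq_augmentation (injectiveResolution M) φ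
  let g := InjectiveResolution.desc f (injectiveResolution N) (injectiveResolution M)
  have comm : (injectiveResolution M).ι.f 0 ≫ g.f 0 = f ≫ (injectiveResolution N).ι.f 0 :=
    InjectiveResolution.desc_commutes_zero f _ _
  -- A lift `g` of `f` to the resolutions carries an extension `y` for `φ` to one for `f ∘ φ`; the
  -- value of `δ` does not depend on the extension used.
  have hg (r : ↥(J ^ n)) : (r : R) • (g.f 0).hom y =
      augmentation (injectiveResolution N) ((f.hom ∘ₗ φ) r) := by
    rw [← map_smul, hy]
    exact LinearMap.congr_fun (congrArg ModuleCat.Hom.hom comm) (φ r)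
  refine (congrArg (δ N) (IdealTransform.map_of J f.hom n φ)).trans
    ((hδ N n _ _ hg).trans ?_)
  refine Eq.trans ?_ (congrArg ((localCoh J 1).map f).hom (hδ M n φ y hy)).symm
  exact (localCoh_map_transporterClass J f g comm _ _ rfl).symm

end

/-! ### The map `η` and the comparison of cokernels -/

noncomputable section

variable {R : Type u} [CommRing R] {k : ℕ} (x : Fin k → R)

theorem rho_map {M N : Type u} [AddCommGroup M] [Module R M] [AddCommGroup N] [Module R N]
    (f : M →ₗ[R] N) (z : IdealTransform (seqIdeal x) M) :
    rho x N (IdealTransform.map (seqIdeal x) f z) = cechD0Map x f (rho x M z) := by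
  obtain ⟨n, φ, rfl⟩ := Module.DirectLimit.exists_of z
  refine Subtype.ext (funext fun i => ?_)
  refine (congrArg (fun t => (rho x N t).1 i) (IdealTransform.map_of _ f n φ)).trans ?_
  refine (rho_of x N n _ i).trans (Eq.trans ?_
    (congrArg (locFun (x i) f) (rho_of x M n φ i)).symm)
  refine smul_pow_injective (dvd_refl (x i)) n ?_
  rw [smul_frac, ← map_smul, smul_frac, locFun_toLoc]
  rfl

/-- The natural transformation induced on local cohomology by the comparison map of the ideal
transform with Čech cocycles. -/
theorem exists_natTrans_cechH1 (δ : idealTransformFunctor (seqIdeal x) ⟶ localCoh (seqIdeal x) 1)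
    (hex : ∀ M : ModuleCat.{u} R, Function.Exact (tau (seqIdeal x) M) (δ.app M).hom)
    (hsurj : ∀ M, Function.Surjective (δ.app M).hom) :
    ∃ η : localCoh (seqIdeal x) 1 ⟶ cechH1Functor x, ∀ (M : ModuleCat.{u} R)
      (z : IdealTransform (seqIdeal x) M),
      (η.app M).hom ((δ.app M).hom z) = cechProj x M (rho x M z) := by
  have h (M : ModuleCat.{u} R) : ∃ g : (localCoh (seqIdeal x) 1).obj M →ₗ[R] CechH1 x M,
      ∀ z, g ((δ.app M).hom z) = cechProj x M (rho x M z) := by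
    let d : IdealTransform (seqIdeal x) M →ₗ[R] (localCoh (seqIdeal x) 1).obj M := (δ.app M).hom
    have hker : LinearMap.ker d ≤ LinearMap.ker (cechProj x M ∘ₗ rho x M) := by
      intro z hz
      obtain ⟨m, rfl⟩ := (hex M z).1 hz
      rw [LinearMap.mem_ker, LinearMap.comp_apply, rho_tau]
      exact (exact_cechAug_cechProj x _).2 ⟨m, rfl⟩
    exact exists_linearMap_of_ker_le (p := d) (hsurj M) hker
  choose g hg using h
  refine ⟨{ app := fun M => ModuleCat.ofHom (g M), naturality := fun M N f => ?_ }, hg⟩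
  refine ModuleCat.hom_ext (LinearMap.ext fun a => ?_)
  obtain ⟨z, rfl⟩ := hsurj M a
  have hn := LinearMap.congr_fun (congrArg ModuleCat.Hom.hom (δ.naturality f)) z
  refine (congrArg (g N) hn.symm).trans ((hg N _).trans ?_)
  refine Eq.trans ?_ (congrArg (cechH1Map x f.hom) (hg M z)).symm
  exact congrArg (cechProj x N) (rho_map x f.hom z)

/-- In a commutative square with surjective `p` and `d`, the map `p` identifies the cokernels of the
other two maps `ρ` and `η` if the kernel of `p` lies in the image of `ρ`. -/
theorem exists_quotient_equiv {D E C H : Type*} [AddCommGroup D] [Module R D] [AddCommGroup E]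
    [Module R E] [AddCommGroup C] [Module R C] [AddCommGroup H] [Module R H] (ρ : D →ₗ[R] C)
    (p : C →ₗ[R] H) (d : D →ₗ[R] E) (η : E →ₗ[R] H) (hp : Function.Surjective p)
    (hd : Function.Surjective d) (hc : ∀ z, η (d z) = p (ρ z))
    (hker : LinearMap.ker p ≤ LinearMap.range ρ) :
    ∃ e : (C ⧸ LinearMap.range ρ) ≃ₗ[R] (H ⧸ LinearMap.range η),
      ∀ f : C, e (Submodule.Quotient.mk f) = Submodule.Quotient.mk (p f) := by
  have hle : LinearMap.range ρ ≤ (LinearMap.range η).comap p := by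
    rintro _ ⟨z, rfl⟩
    exact ⟨d z, hc z⟩
  refine ⟨LinearEquiv.ofBijective ((LinearMap.range ρ).mapQ (LinearMap.range η) p hle)
    ⟨?_, ?_⟩, fun f => rfl⟩
  · rw [injective_iff_map_eq_zero]
    intro a ha
    obtain ⟨f, rfl⟩ := Submodule.mkQ_surjective _ a
    obtain ⟨b, hb⟩ := (Submodule.Quotient.mk_eq_zero _).1 ha
    obtain ⟨z, rfl⟩ := hd b
    -- Since `p f = η (d z) = p (ρ z)`, the difference `f - ρ z` lies in the kernel of `p`, hence in
    -- the image of `ρ`.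
    obtain ⟨w, hw⟩ := hker (x := f - ρ z) (by rw [LinearMap.mem_ker, map_sub, ← hc, hb, sub_self])
    refine (Submodule.Quotient.mk_eq_zero _).2 ⟨w + z, ?_⟩
    rw [map_add, hw, sub_add_cancel]
  · intro b
    obtain ⟨b, rfl⟩ := Submodule.mkQ_surjective _ b
    obtain ⟨f, rfl⟩ := hp b
    exact ⟨Submodule.Quotient.mk f, rfl⟩

end

end CechLocal

theorem lemma4p1 {R : Type u} [CommRing R] {k : ℕ} (x : Fin k → R) :
    ∃ (δ : CechLocal.idealTransformFunctor (CechLocal.seqIdeal x) ⟶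
          CechLocal.localCoh (CechLocal.seqIdeal x) 1)
      (η : CechLocal.localCoh (CechLocal.seqIdeal x) 1 ⟶ CechLocal.cechH1Functor x),
      ∀ M : ModuleCat.{u} R,
        -- the upper row is exact
        Function.Exact (CechLocal.torsion (CechLocal.seqIdeal x) M).subtype
          (CechLocal.tau (CechLocal.seqIdeal x) M) ∧
        Function.Exact (CechLocal.tau (CechLocal.seqIdeal x) M) (δ.app M).hom ∧
        Function.Surjective (δ.app M).hom ∧
        -- the lower row is exact
        Function.Exact (CechLocal.CechH0 x M).subtype (CechLocal.cechAug x M) ∧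
        Function.Exact (CechLocal.cechAug x M) (CechLocal.cechProj x M) ∧
        Function.Surjective (CechLocal.cechProj x M) ∧
        -- the three squares commute (the first one, between submodules of `M`, is an equality)
        CechLocal.torsion (CechLocal.seqIdeal x) M = CechLocal.CechH0 x M ∧
        (∀ m : M, CechLocal.rho x M (CechLocal.tau (CechLocal.seqIdeal x) M m) =
          CechLocal.cechAug x M m) ∧
        (∀ φ : CechLocal.IdealTransform (CechLocal.seqIdeal x) M,
          (η.app M).hom ((δ.app M).hom φ) = CechLocal.cechProj x M (CechLocal.rho x M φ)) ∧
        -- the last two vertical maps are injective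
        Function.Injective (CechLocal.rho x M) ∧
        Function.Injective (η.app M).hom ∧
        -- the lower row induces an isomorphism of the cokernels of these two maps
        (∃ e : (CechLocal.CechD0 x M ⧸ LinearMap.range (CechLocal.rho x M)) ≃ₗ[R]
            (CechLocal.CechH1 x M ⧸ LinearMap.range (η.app M).hom),
          ∀ f : CechLocal.CechD0 x M,
            e (Submodule.Quotient.mk f) = Submodule.Quotient.mk (CechLocal.cechProj x M f)) ∧
        (CechLocal.WeaklyProRegular x → Function.Bijective (CechLocal.rho x M)) := by
  obtain ⟨δ, hδ⟩ := CechLocal.exists_natTrans_localCoh (CechLocal.seqIdeal x)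
  obtain ⟨η, hη⟩ := CechLocal.exists_natTrans_cechH1 x δ (fun M => (hδ M).1) fun M => (hδ M).2
  refine ⟨δ, η, fun M => ⟨CechLocal.exact_torsion_tau _, (hδ M).1, (hδ M).2,
    CechLocal.exact_cechH0_cechAug x, CechLocal.exact_cechAug_cechProj x,
    CechLocal.cechProj_surjective x, CechLocal.torsion_eq_cechH0 x, CechLocal.rho_tau x, hη M,
    CechLocal.rho_injective x, ?_, ?_, fun hx => ⟨CechLocal.rho_injective x, hx.rho_surjective⟩⟩⟩
  · rw [injective_iff_map_eq_zero]
    intro a ha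
    -- If `η (δ z) = 0`, then `ρ z` is the image of some `m`, so `ρ z = ρ (τ m)`. Injectivity of `ρ`
    -- gives `z = τ m`, whence `δ z = 0`.
    obtain ⟨z, rfl⟩ := (hδ M).2 a
    obtain ⟨m, hm⟩ := (CechLocal.exact_cechAug_cechProj x _).1 ((hη M z).symm.trans ha)
    exact ((hδ M).1 z).2
      ⟨m, CechLocal.rho_injective x ((CechLocal.rho_tau x m).trans hm)⟩
  · refine CechLocal.exists_quotient_equiv (CechLocal.rho x M) (CechLocal.cechProj x M)
      (δ.app M).hom (η.app M).hom (CechLocal.cechProj_surjective x) (hδ M).2 (hη M) fun f hf => ?_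
    obtain ⟨m, rfl⟩ := (CechLocal.exact_cechAug_cechProj x f).1 hf
    exact ⟨CechLocal.tau _ M m, CechLocal.rho_tau x m⟩
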